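/- Throughout, $\log$ is the natural logarithm, $M>1$, $\mathcal R=[1/M,M]$, $\mathcal L_3=\{y\in\mathbb R^3: y_3\ge\sqrt{y_1^2+y_2^2}\}$, and $\mathrm{hyp}\log(\alpha)=\{(x,\nu)\in\mathcal R\times\mathbb R:\log x\ge \nu-\alpha\}$. For a positive integer $s$ put $$\phi_2(t,x)=\frac{2^s(x^{1/2^s}-1)}{2+(t+1)(x^{1/2^s}-1)},\qquad \rho=\frac{M^{1/2^s}+1}{M^{1/2^s}-1},\qquad L=\frac{2^s}{\frac{M^{1/2^s}+1}{M^{1/2^s}-1}-\frac{\rho}{2}-\frac{\rho^{-1}}{2}}.$$ Let $t_1<\dots<t_N$ and $w_1,\dots,w_N$ be the nodes and weights of the $N$-point Gauss–Legendre quadrature rule on $[-1,1]$, $N\ge 1$, and let $$\widehat H_{\phi_2,N}=\Big\{(x,\nu)\in\mathcal R\times\mathbb R:\ \exists v\in\mathbb R^N,\ \sum_{k=1}^N w_kv_k\ge\nu,\ \phi_2(t_k,x)\ge v_k\ (k=1,\dots,N)\Big\}.$$ (1) For every $M>1$ and every $s\ge1$ we have $\rho>1$, $0<L<\infty$; for all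 $x\in\mathcal R$ the function $z\mapsto\phi_2(z,x)$ has no pole in, and satisfies $|\phi_2(z,x)|\le L$ on, the closed region bounded by the ellipse $\{\frac{\rho}{2}e^{i\theta}+\frac{\rho^{-1}}{2}e^{-i\theta}:\theta\in[0,2\pi]\}$; and for all $N\ge 1$ and $x\in\mathcal R$ $$\Big|\log x-\sum_{k=1}^N w_k\phi_2(t_k,x)\Big|\le\frac{64\,L\,\rho^{-2(N-1)}}{15(\rho^2-1)} .$$ (2) For all $M>1$ and $N,s\ge1$, $\widehat H_{\phi_2,N}$ is the set of all $(x,\nu)\in\mathcal R\times\mathbb R$ for which there are $v\in\mathbb R^N$ and $r\in\mathbb R^s$ with $$\begin{aligned}&\textstyle\sum_{k}w_kv_k\ge\nu,\quad r_i\ge0\ (1\le i\le s),\\ &(2r_1,x-1,x+1)\in\mathcal L_3,\quad (2r_{i+1},r_i-1,r_i+1)\in\mathcal L_3\ (1\le i\le s-1),\\ &\gamma_{1k}=2^s-(t_k+1)v_k\ge0,\quad \gamma_{2k}=r_s-1-2^{1-s}v_k\ge0,\\ &\big(v_k\sqrt{2^{3-s}(t_k+1)},\gamma_{1k}-\gamma_{2k},\gamma_{1k}+\gamma_{2k}\big)\in\mathcal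 L_3\quad(1\le k\le N),\end{aligned}$$ and these constraints (together with $x\in\mathcal R$) on $(x,\nu,v,r)$ can be written as a system of $3+2s+3N$ constraints of the form $(a_1^\top y+b_1,a_2^\top y+b_2,a_3^\top y+b_3)\in\mathcal L_3$ in $2+N+s$ variables $y$. (3) Take $s=N$. There is an absolute constant $C>0$ such that for all $M>1$ and $\varepsilon>0$ there is $N_0\ge1$ for which the total number $(2+2N_0)+(3+5N_0)$ of variables and constraints in (2) with $s=N=N_0$ is at most $$C\Big(1+\max\{\log\log M,0\}+\sqrt{\max\{\log M+\log(1/\varepsilon),0\}}\Big),$$ and for every $N\ge N_0$ (with $s=N$) $$\mathrm{hyp}\log(-\varepsilon)\subseteq\widehat H_{\phi_2,N}\subseteq\mathrm{hyp}\log(\varepsilon).$$ In particular, for $M\ge e$ and $\varepsilon\le1$, $N=O(\log\log M+\sqrt{\log M+\log(1/\varepsilon)})$ points, and as many variables and second-order cone constraints up to a constant factor, suffice. -/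

import Mathlib

open scoped BigOperators

noncomputable section

namespace LogSOC

/-- The interval `[1/M, M]`. -/
def interval (M : ℝ) : Set ℝ := Set.Icc (1 / M) M

/-- The shifted hypograph `{(x, ν) : x ∈ [1/M, M], log x ≥ ν - α}` of the natural logarithm. -/
def hypLog (M α : ℝ) : Set (ℝ × ℝ) :=
  {p | p.1 ∈ interval M ∧ Real.log p.1 ≥ p.2 - α}

/-- The hypograph over `[1/M, M]` of the concave function `φ t`. -/
def hypGen (M : ℝ) (φ : ℝ → ℝ → ℝ) (t : ℝ) : Set (ℝ × ℝ) :=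
  {p | p.1 ∈ interval M ∧ φ t p.1 ≥ p.2}

/-! ### Gauss-Legendre quadrature on `[-1, 1]` -/

/-- The Legendre polynomial of degree `N`, by Rodrigues' formula. -/
def legendre (N : ℕ) : Polynomial ℝ :=
  Polynomial.C (((2 : ℝ) ^ N * (N.factorial : ℝ))⁻¹) *
    Polynomial.derivative^[N] ((Polynomial.X ^ 2 - 1) ^ N)

/-- The `N` Gauss nodes: the roots of the Legendre polynomial of degree `N` in increasing order.
(That polynomial has `N` simple real roots, so the default value of `getD` does not occur.) -/
def gaussNode (N : ℕ) (k : Fin N) : ℝ :=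
  ((legendre N).roots.sort (· ≤ ·)).getD k 0

/-- The Gauss weights: the integrals over `[-1, 1]` of the Lagrange basis polynomials of the
nodes. -/
def gaussWeight (N : ℕ) (k : Fin N) : ℝ :=
  ∫ τ in (-1 : ℝ)..1, (Lagrange.basis Finset.univ (gaussNode N) k).eval τ

/-- The approximation of the hypograph of the logarithm that is obtained from a function `φ` with
`∫_{-1}^1 φ t x dt = log x + c` by the `N`-point Gauss rule:
`{(x, ν) : x ∈ [1/M, M], ∃ v, ∑ w_k v_k ≥ ν + c, (x, v_k) ∈ hyp φ(t_k) for all k}`. -/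
def Hhat (M : ℝ) (φ : ℝ → ℝ → ℝ) (c : ℝ) (N : ℕ) : Set (ℝ × ℝ) :=
  {p | p.1 ∈ interval M ∧ ∃ v : Fin N → ℝ,
    ∑ k, gaussWeight N k * v k ≥ p.2 + c ∧ ∀ k, (p.1, v k) ∈ hypGen M φ (gaussNode N k)}

/-! ### The generating function -/

/-- `x ^ (1 / 2 ^ s)`. -/
def dyadicRoot (s : ℕ) (x : ℝ) : ℝ := x ^ ((1 : ℝ) / 2 ^ s)

/-- `φ₂(t, x) = 2^s (x^{1/2^s} - 1) / (2 + (t + 1) (x^{1/2^s} - 1))`. -/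
def phi2 (s : ℕ) (t x : ℝ) : ℝ :=
  2 ^ s * (dyadicRoot s x - 1) / (2 + (t + 1) * (dyadicRoot s x - 1))

/-- The denominator of `φ₂` at a complex first argument. -/
def phi2DenC (s : ℕ) (z : ℂ) (x : ℝ) : ℂ :=
  2 + (z + 1) * ((dyadicRoot s x : ℂ) - 1)

/-- `φ₂` at a complex first argument. -/
def phi2C (s : ℕ) (z : ℂ) (x : ℝ) : ℂ :=
  2 ^ s * ((dyadicRoot s x : ℂ) - 1) / phi2DenC s z x

theorem phi2C_ofReal (s : ℕ) (t x : ℝ) : phi2C s (t : ℂ) x = (phi2 s t x : ℂ) := by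
  simp [phi2C, phi2DenC, phi2]

/-- The ellipse with foci `±1` traced by `(r e^{iθ} + r⁻¹ e^{-iθ}) / 2`, `0 ≤ θ ≤ 2π`. -/
def bernsteinEllipse (r : ℝ) : Set ℂ :=
  {z | ∃ θ ∈ Set.Icc (0 : ℝ) (2 * Real.pi),
    z = (r : ℂ) / 2 * Complex.exp (Complex.I * θ) +
      (r : ℂ)⁻¹ / 2 * Complex.exp (-(Complex.I * θ))}

/-- `ρ = (M^{1/2^s} + 1) / (M^{1/2^s} - 1)`. -/
def rho (M : ℝ) (s : ℕ) : ℝ := (dyadicRoot s M + 1) / (dyadicRoot s M - 1)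

/-- `L = 2^s / ((M^{1/2^s} + 1) / (M^{1/2^s} - 1) - ρ / 2 - ρ⁻¹ / 2)`. -/
def bigL (M : ℝ) (s : ℕ) : ℝ :=
  2 ^ s / ((dyadicRoot s M + 1) / (dyadicRoot s M - 1) - rho M s / 2 - (rho M s)⁻¹ / 2)

/-! ### Second-order cone representations -/

/-- The Lorentz cone in `ℝ^{q+1}`. -/
def lorentz (q : ℕ) : Set (Fin (q + 1) → ℝ) :=
  {y | Real.sqrt (∑ i : Fin q, y i.castSucc ^ 2) ≤ y (Fin.last q)}

/-- The data of a system of `m` second-order cone constraints in `n` variables. -/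
structure SOCSystem (n m : ℕ) where
  A₁ : Matrix (Fin m) (Fin n) ℝ
  A₂ : Matrix (Fin m) (Fin n) ℝ
  A₃ : Matrix (Fin m) (Fin n) ℝ
  b₁ : Fin m → ℝ
  b₂ : Fin m → ℝ
  b₃ : Fin m → ℝ

/-- The solutions `y` of a system: all triples `(a_{i1}ᵀ y + b_{i1}, a_{i2}ᵀ y + b_{i2},
a_{i3}ᵀ y + b_{i3})` lie in the three-dimensional Lorentz cone. -/
def SOCSystem.solutions {n m : ℕ} (S : SOCSystem n m) : Set (Fin n → ℝ) :=
  {y | ∀ i, ![Matrix.mulVec S.A₁ y i + S.b₁ i, Matrix.mulVec S.A₂ y i + S.b₂ i,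
    Matrix.mulVec S.A₃ y i + S.b₃ i] ∈ lorentz 2}

/-- The explicit constraints on `x`, `ν`, `v_1, …, v_N` and `r_1, …, r_s`
(here `r_i` is `r ⟨i - 1, _⟩`). -/
structure Constraints (M : ℝ) (N s : ℕ) (hs : 0 < s) (x ν : ℝ) (v : Fin N → ℝ) (r : Fin s → ℝ) :
    Prop where
  mem_interval : x ∈ interval M
  sum_ge : ∑ k, gaussWeight N k * v k ≥ ν
  r_nonneg : ∀ i, 0 ≤ r i
  chain_first : ![2 * r ⟨0, hs⟩, x - 1, x + 1] ∈ lorentz 2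
  chain_step : ∀ (i : ℕ) (hi : i + 1 < s),
    ![2 * r ⟨i + 1, hi⟩, r ⟨i, Nat.lt_of_succ_lt hi⟩ - 1, r ⟨i, Nat.lt_of_succ_lt hi⟩ + 1]
      ∈ lorentz 2
  gamma : ∀ k, ∃ γ₁ γ₂ : ℝ,
    γ₁ = 2 ^ s - (gaussNode N k + 1) * v k ∧ 0 ≤ γ₁ ∧
    γ₂ = r ⟨s - 1, Nat.sub_lt hs Nat.one_pos⟩ - 1 - (2 : ℝ) ^ (1 - (s : ℤ)) * v k ∧ 0 ≤ γ₂ ∧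
    ![v k * Real.sqrt ((2 : ℝ) ^ (3 - (s : ℤ)) * (gaussNode N k + 1)), γ₁ - γ₂, γ₁ + γ₂]
      ∈ lorentz 2

/-- `1 + (log log M)⁺ + √((log M + log (1/ε))⁺)`. -/
def rate (M ε : ℝ) : ℝ :=
  1 + max (Real.log (Real.log M)) 0 + Real.sqrt (max (Real.log M + Real.log (1 / ε)) 0)

end LogSOC

end

namespace LogSOC

open Polynomial

/-! ### Legendre polynomials -/

/-! With `m = x^(1/2^s)` and `a = (m - 1)/(m + 1)` one has `φ₂(t, x) = 2^s a/(1 + a t)`, whose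
integral over `[-1, 1]` is `2^s log m = log x` (`integral_phi2`). On `[1/M, M]`, `|a| ≤ 1/ρ`, so the
geometric series in `t`, cut after degree `2N - 1`, is off by at most `2^s ρ^(-(2N+1))/(1 - 1/ρ)`.
The Gauss rule is exact on the truncation and has nonnegative weights of total 2, hence errs by at
most four times that (`abs_log_sub_gauss_le`). This already lies below the bound with `L`, so no
contour integral is needed; the estimate on the ellipses is a separate triangle inequality
(`phi2C_bound`).

In the cone form, the chain of squares only forces `r_s ≤ m`, which is enough because `φ₂` increases
with `m`; and `v ≤ φ₂` is a rotated cone condition because the `v²` terms cancel (`gamma_cone_iff`).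

For the rate, `s = N` gives `1/ρ ≤ log M / 2^N`. Once `N ≥ 2` and `2^N ≥ 4 (log M)²`, the error is
at most `2^(-N²)` (`geometric_error_le`), whence the `log log M` and the square root. -/

theorem eval_iterate_derivative_X_sq_sub_one_pow {n k : ℕ} (hk : k < n) {x : ℝ}
    (hx : x ^ 2 = 1) : (derivative^[k] ((X ^ 2 - 1 : ℝ[X]) ^ n)).eval x = 0 := by
  obtain ⟨q, hq⟩ := pow_sub_dvd_iterate_derivative_pow (X ^ 2 - 1 : ℝ[X]) n k
  rw [hq, eval_mul, eval_pow]
  simp [hx, Nat.sub_ne_zero_of_lt hk]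

theorem iterate_derivative_X_sq_sub_one_pow_ne_zero {n k : ℕ} (hk : k ≤ n) :
    derivative^[k] ((X ^ 2 - 1 : ℝ[X]) ^ n) ≠ 0 := by
  have hm : (X ^ 2 - 1 : ℝ[X]).Monic := by
    simpa using monic_X_pow_sub_C (1 : ℝ) (n := 2) two_ne_zero
  have hd : ((X ^ 2 - 1 : ℝ[X]) ^ n).natDegree = n * 2 := by
    rw [natDegree_pow]
    congr 1
    simpa using natDegree_X_pow_sub_C (n := 2) (r := (1 : ℝ))
  have hc : ((X ^ 2 - 1 : ℝ[X]) ^ n).coeff (n * 2) = 1 := by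
    rw [← hd]; exact (hm.pow n).coeff_natDegree
  intro h
  -- The coefficient at degree `2n - k` is the falling factorial of `2n` of length `k`, nonzero
  -- since `k ≤ 2n`.
  have h2 := congrArg (fun p => p.coeff (n * 2 - k)) h
  simp only [coeff_iterate_derivative, coeff_zero] at h2
  rw [Nat.sub_add_cancel (by omega), hc] at h2
  simp only [nsmul_eq_mul, mul_one, Nat.cast_eq_zero, Nat.descFactorial_eq_zero_iff_lt] at h2
  omega

/-- The `k`-th derivative of `(X² - 1)^n` has `k` distinct roots in `(-1, 1)`, for `k ≤ n`. -/
theorem exists_roots_iterate_derivative_X_sq_sub_one_pow (n k : ℕ) (hk : k ≤ n) :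
    ∃ S : Finset ℝ, S.card = k ∧ ∀ x ∈ S, x ∈ Set.Ioo (-1 : ℝ) 1 ∧
      (derivative^[k] ((X ^ 2 - 1 : ℝ[X]) ^ n)).eval x = 0 := by
  induction k with
  | zero => exact ⟨∅, by simp⟩
  | succ k ih =>
    obtain ⟨S, hS, hSr⟩ := ih (by omega)
    set p := derivative^[k] ((X ^ 2 - 1 : ℝ[X]) ^ n) with hp
    have hp' : derivative^[k + 1] ((X ^ 2 - 1 : ℝ[X]) ^ n) = derivative p := by
      rw [Function.iterate_succ_apply']
    have hne : derivative p ≠ 0 := hp' ▸ iterate_derivative_X_sq_sub_one_pow_ne_zero hk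
    rw [hp']
    have h1S : (1 : ℝ) ∉ S := fun h => lt_irrefl _ (hSr _ h).1.2
    have h2S : (-1 : ℝ) ∉ insert 1 S := by
      rw [Finset.mem_insert, not_or]
      exact ⟨by norm_num, fun h => lt_irrefl _ (hSr _ h).1.1⟩
    -- The endpoints are zeros as well because `k < n`; these two extra zeros turn the loss of one
    -- zero in Rolle's theorem into a gain of one.
    set T : Finset ℝ := insert (-1) (insert 1 S) with hT
    have hTc : T.card = k + 2 := by
      rw [hT, Finset.card_insert_of_notMem h2S, Finset.card_insert_of_notMem h1S, hS]
    have hTr : ∀ x ∈ T, x ∈ Set.Icc (-1 : ℝ) 1 ∧ p.eval x = 0 := by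
      intro x hx
      simp only [hT, Finset.mem_insert] at hx
      rcases hx with rfl | rfl | hx
      · exact ⟨by norm_num, eval_iterate_derivative_X_sq_sub_one_pow hk (by norm_num)⟩
      · exact ⟨by norm_num, eval_iterate_derivative_X_sq_sub_one_pow hk (by norm_num)⟩
      · exact ⟨Set.Ioo_subset_Icc_self (hSr x hx).1, (hSr x hx).2⟩
    set U : Finset ℝ := (derivative p).roots.toFinset.filter (fun x => x ∈ Set.Ioo (-1 : ℝ) 1)
      with hU
    have hle : T.card ≤ (U \ T).card + 1 := by
      refine Finset.card_le_sdiff_of_interleaved fun x hx y hy hxy _ => ?_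
      obtain ⟨z, hz, hz'⟩ := exists_deriv_eq_zero hxy p.continuousOn
        ((hTr x hx).2.trans (hTr y hy).2.symm)
      refine ⟨z, ?_, hz⟩
      rw [Polynomial.deriv] at hz'
      rw [hU, Finset.mem_filter, Multiset.mem_toFinset, mem_roots hne]
      exact ⟨hz', (hTr x hx).1.1.trans_lt hz.1, hz.2.trans_le (hTr y hy).1.2⟩
    have hle' : k + 1 ≤ U.card := by
      have := Finset.card_le_card (Finset.sdiff_subset : U \ T ⊆ U)
      omega
    obtain ⟨V, hVU, hV⟩ := Finset.exists_subset_card_eq hle'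
    refine ⟨V, hV, fun x hx => ?_⟩
    have := hVU hx
    rw [hU, Finset.mem_filter, Multiset.mem_toFinset, mem_roots hne] at this
    exact ⟨this.2, this.1⟩

theorem legendre_ne_zero (N : ℕ) : legendre N ≠ 0 := by
  refine mul_ne_zero (C_ne_zero.2 (by positivity))
    (iterate_derivative_X_sq_sub_one_pow_ne_zero le_rfl)

theorem natDegree_legendre_le (N : ℕ) : (legendre N).natDegree ≤ N := by
  refine (natDegree_C_mul_le _ _).trans ((natDegree_iterate_derivative _ _).trans ?_)
  have : ((X ^ 2 - 1 : ℝ[X]) ^ N).natDegree ≤ N * 2 := by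
    refine natDegree_pow_le.trans (Nat.mul_le_mul_left _ ?_)
    compute_degree
  omega

theorem exists_roots_legendre (N : ℕ) :
    ∃ S : Finset ℝ, S.card = N ∧ (legendre N).roots = S.val ∧
      ∀ x ∈ S, x ∈ Set.Ioo (-1 : ℝ) 1 := by
  obtain ⟨S, hS, hSr⟩ := exists_roots_iterate_derivative_X_sq_sub_one_pow N N le_rfl
  refine ⟨S, hS, ?_, fun x hx => (hSr x hx).1⟩
  -- `N` distinct roots exhaust the root multiset of a polynomial of degree at most `N`, so all
  -- roots are simple.
  have hle : S.val ≤ (legendre N).roots := by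
    rw [Multiset.le_iff_subset S.nodup]
    intro x hx
    rw [mem_roots (legendre_ne_zero N), IsRoot, legendre, eval_mul, (hSr x hx).2, mul_zero]
  refine (Multiset.eq_of_le_of_card_le hle ?_).symm
  exact ((card_roots' _).trans (natDegree_legendre_le N)).trans_eq hS.symm

theorem natDegree_legendre (N : ℕ) : (legendre N).natDegree = N := by
  obtain ⟨S, hS, hr, -⟩ := exists_roots_legendre N
  refine le_antisymm (natDegree_legendre_le N) ?_
  have := card_roots' (legendre N)
  rw [hr, Finset.card_val, hS] at this
  exact this

theorem gaussNode_spec (N : ℕ) : Function.Injective (gaussNode N) ∧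
    (∀ k, gaussNode N k ∈ Set.Ioo (-1 : ℝ) 1) ∧ ∀ k, (legendre N).eval (gaussNode N k) = 0 := by
  obtain ⟨S, hS, hr, hSI⟩ := exists_roots_legendre N
  have hlen : ((legendre N).roots.sort (· ≤ ·)).length = N := by
    rw [Multiset.length_sort, hr, Finset.card_val, hS]
  have hnd : ((legendre N).roots.sort (· ≤ ·)).Nodup := by
    rw [← Multiset.coe_nodup, Multiset.sort_eq, hr]; exact S.nodup
  have hget : ∀ k : Fin N, gaussNode N k =
      ((legendre N).roots.sort (· ≤ ·))[(k : ℕ)]'(by rw [hlen]; exact k.2) := by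
    intro k
    rw [gaussNode, List.getD_eq_getElem]
  have hmem : ∀ k, gaussNode N k ∈ (legendre N).roots := by
    intro k
    rw [hget k, ← Multiset.mem_sort (r := (· ≤ ·))]
    exact List.getElem_mem _
  refine ⟨fun i j hij => ?_, fun k => ?_, fun k => (mem_roots'.1 (hmem k)).2⟩
  · rw [hget, hget, hnd.getElem_inj_iff] at hij
    exact Fin.ext hij
  · have := hmem k
    rw [hr] at this
    exact hSI _ this

theorem gaussNode_injective (N : ℕ) : Function.Injective (gaussNode N) := (gaussNode_spec N).1

theorem gaussNode_mem (N : ℕ) (k : Fin N) : gaussNode N k ∈ Set.Ioo (-1 : ℝ) 1 :=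
  (gaussNode_spec N).2.1 k

/-! ### Gauss quadrature -/

theorem intervalIntegrable_eval (p : ℝ[X]) (a b : ℝ) :
    IntervalIntegrable (fun τ => p.eval τ) MeasureTheory.volume a b :=
  p.continuous.intervalIntegrable a b

/-- Integration by parts `n` times: every boundary term vanishes, and each step lowers the degree of
`q` until nothing is left. -/
theorem integral_iterate_derivative_mul_eq_zero (p : ℝ[X]) (n : ℕ)
    (hp : ∀ i < n, (derivative^[i] p).eval 1 = 0 ∧ (derivative^[i] p).eval (-1) = 0)
    (q : ℝ[X]) (hq : q.degree < n) :
    ∫ τ in (-1 : ℝ)..1, (derivative^[n] p * q).eval τ = 0 := by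
  induction n generalizing q with
  | zero =>
    have : q = 0 := by
      by_contra h
      rw [degree_eq_natDegree h] at hq
      exact absurd (Nat.cast_lt.1 hq) (Nat.not_lt_zero _)
    simp [this]
  | succ n ih =>
    have hq' : (derivative q).degree < n := by
      rcases eq_or_ne q 0 with rfl | h0
      · simp
      · have h1 := degree_derivative_lt h0
        rw [degree_eq_natDegree h0] at h1 hq
        have h2 : q.natDegree ≤ n := Nat.lt_succ_iff.1 (Nat.cast_lt.1 hq)
        exact h1.trans_le (Nat.cast_le.2 h2)
    have h := intervalIntegral.integral_mul_deriv_eq_deriv_mul (a := -1) (b := 1)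
      (fun x _ => q.hasDerivAt x) (fun x _ => (derivative^[n] p).hasDerivAt x)
      (intervalIntegrable_eval _ _ _) (intervalIntegrable_eval _ _ _)
    have h3 := ih (fun i hi => hp i (by omega)) _ hq'
    simp only [eval_mul] at h3 ⊢
    rw [Function.iterate_succ_apply']
    simp only [mul_comm (eval _ (derivative (derivative^[n] p)))]
    rw [h, (hp n (by omega)).1, (hp n (by omega)).2]
    simp only [mul_comm (eval _ (derivative q)), h3]
    ring

theorem integral_legendre_mul_eq_zero (N : ℕ) (q : ℝ[X]) (hq : q.degree < N) :
    ∫ τ in (-1 : ℝ)..1, (legendre N * q).eval τ = 0 := by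
  have h := integral_iterate_derivative_mul_eq_zero ((X ^ 2 - 1 : ℝ[X]) ^ N) N
    (fun i hi => ⟨eval_iterate_derivative_X_sq_sub_one_pow hi (by norm_num),
      eval_iterate_derivative_X_sq_sub_one_pow hi (by norm_num)⟩) q hq
  simp only [legendre, mul_assoc, eval_C_mul (p := _ * q)]
  rw [intervalIntegral.integral_const_mul, h, mul_zero]

theorem sum_gaussWeight_of_degree_lt (N : ℕ) (p : ℝ[X]) (hp : p.degree < N) :
    ∑ k, gaussWeight N k * p.eval (gaussNode N k) = ∫ τ in (-1 : ℝ)..1, p.eval τ := by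
  have h := Lagrange.eq_interpolate (s := Finset.univ) (v := gaussNode N) (f := p)
    (gaussNode_injective N).injOn (by simpa using hp)
  have h2 : ∀ τ, p.eval τ = ∑ k, p.eval (gaussNode N k) *
      (Lagrange.basis Finset.univ (gaussNode N) k).eval τ := by
    intro τ
    conv_lhs => rw [h]
    simp [Lagrange.interpolate_apply, eval_finsetSum]
  rw [intervalIntegral.integral_congr fun τ _ => h2 τ, intervalIntegral.integral_finsetSum]
  · refine Finset.sum_congr rfl fun k _ => ?_
    rw [intervalIntegral.integral_const_mul, gaussWeight, mul_comm]
  · intro k _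
    exact (intervalIntegrable_eval _ _ _).const_mul _

/-- The `N`-point Gauss rule is exact on polynomials of degree less than `2 N`. -/
theorem sum_gaussWeight_mul_eval (N : ℕ) (p : ℝ[X]) (hp : p.natDegree < 2 * N) :
    ∑ k, gaussWeight N k * p.eval (gaussNode N k) = ∫ τ in (-1 : ℝ)..1, p.eval τ := by
  have hd : (legendre N).degree = N := by
    rw [degree_eq_natDegree (legendre_ne_zero N), natDegree_legendre]
  have hr : (p % legendre N).degree < N := hd ▸ degree_mod_lt p (legendre_ne_zero N)
  have hq : (p / legendre N).degree < N := by
    by_cases h0 : p / legendre N = 0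
    · rw [h0, degree_zero]; exact WithBot.bot_lt_coe _
    · have h1 := degree_add_div (legendre_ne_zero N)
        (not_lt.1 (mt (Polynomial.div_eq_zero_iff (legendre_ne_zero N)).2 h0))
      rw [← degree_mul] at h1
      have h2 := natDegree_eq_of_degree_eq h1
      rw [natDegree_mul (legendre_ne_zero N) h0, natDegree_legendre] at h2
      rw [degree_eq_natDegree h0]
      exact Nat.cast_lt.2 (by omega)
  -- Division by the Legendre polynomial: the multiple of it vanishes at the nodes and, by
  -- orthogonality, integrates to zero, so only the remainder counts on both sides.
  have hev : ∀ τ, p.eval τ = (legendre N * (p / legendre N)).eval τ + (p % legendre N).eval τ := by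
    intro τ
    rw [← eval_add, EuclideanDomain.div_add_mod]
  have hev' : ∀ k, p.eval (gaussNode N k) = (p % legendre N).eval (gaussNode N k) := by
    intro k
    rw [hev, eval_mul, (gaussNode_spec N).2.2 k]; ring
  simp only [hev']
  rw [sum_gaussWeight_of_degree_lt N _ hr]
  simp only [hev]
  rw [intervalIntegral.integral_add (intervalIntegrable_eval _ _ _)
    (intervalIntegrable_eval _ _ _), integral_legendre_mul_eq_zero N _ hq, zero_add]

/-- The rule is exact on the square of a Lagrange basis polynomial, of degree `2N - 2`, and returns
exactly the weight. -/
theorem gaussWeight_nonneg (N : ℕ) (k : Fin N) : 0 ≤ gaussWeight N k := by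
  set b := Lagrange.basis Finset.univ (gaussNode N) k with hb
  have hN : 0 < N := k.pos
  have hbd : b.natDegree = N - 1 := by
    rw [hb, Lagrange.natDegree_basis (gaussNode_injective N).injOn (Finset.mem_univ k)]
    simp
  have h := sum_gaussWeight_mul_eval N (b ^ 2) (by rw [natDegree_pow, hbd]; omega)
  rw [Finset.sum_eq_single k] at h
  · rw [eval_pow, hb, Lagrange.eval_basis_self (gaussNode_injective N).injOn (Finset.mem_univ k),
      one_pow, mul_one] at h
    rw [h]
    refine intervalIntegral.integral_nonneg (by norm_num) fun τ _ => ?_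
    rw [eval_pow]; positivity
  · intro j _ hj
    rw [eval_pow, hb, Lagrange.eval_basis_of_ne hj.symm (Finset.mem_univ j)]; ring
  · simp

theorem sum_gaussWeight {N : ℕ} (hN : 0 < N) : ∑ k, gaussWeight N k = 2 := by
  have h := sum_gaussWeight_mul_eval N 1 (by simpa using hN)
  simp only [eval_one, mul_one] at h
  rw [h]; norm_num

/-- Error of the Gauss rule for a function that is uniformly close to a polynomial of degree less
than `2 N`. -/
theorem abs_integral_sub_gauss_le {N : ℕ} (hN : 0 < N) {f : ℝ → ℝ}
    (hf : ContinuousOn f (Set.Icc (-1) 1)) (p : ℝ[X]) (hp : p.natDegree < 2 * N) {δ : ℝ}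
    (hδ : ∀ t ∈ Set.Icc (-1 : ℝ) 1, |f t - p.eval t| ≤ δ) :
    |(∫ τ in (-1 : ℝ)..1, f τ) - ∑ k, gaussWeight N k * f (gaussNode N k)| ≤ 4 * δ := by
  have h1 : |(∫ τ in (-1 : ℝ)..1, f τ) - ∫ τ in (-1 : ℝ)..1, p.eval τ| ≤ 2 * δ := by
    have hfi : IntervalIntegrable f MeasureTheory.volume (-1) 1 :=
      ContinuousOn.intervalIntegrable (by rwa [Set.uIcc_of_le (by norm_num)])
    rw [← intervalIntegral.integral_sub hfi (intervalIntegrable_eval _ _ _)]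
    have := intervalIntegral.norm_integral_le_of_norm_le_const (a := -1) (b := 1)
      (f := fun τ => f τ - p.eval τ) (C := δ) (fun t ht => by
        rw [Set.uIoc_of_le (by norm_num)] at ht
        exact hδ t (Set.Ioc_subset_Icc_self ht))
    rw [Real.norm_eq_abs] at this
    refine this.trans_eq ?_
    norm_num [mul_comm]
  have h2 : |(∫ τ in (-1 : ℝ)..1, p.eval τ) - ∑ k, gaussWeight N k * f (gaussNode N k)|
      ≤ 2 * δ := by
    rw [← sum_gaussWeight_mul_eval N p hp, ← Finset.sum_sub_distrib, ← sum_gaussWeight hN,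
      Finset.sum_mul]
    refine (Finset.abs_sum_le_sum_abs _ _).trans (Finset.sum_le_sum fun k _ => ?_)
    rw [← mul_sub, abs_mul, abs_of_nonneg (gaussWeight_nonneg N k), abs_sub_comm]
    exact mul_le_mul_of_nonneg_left (hδ _ (Set.Ioo_subset_Icc_self (gaussNode_mem N k)))
      (gaussWeight_nonneg N k)
  calc _ ≤ _ := abs_sub_le _ (∫ τ in (-1 : ℝ)..1, p.eval τ) _
    _ ≤ 2 * δ + 2 * δ := add_le_add h1 h2
    _ = 4 * δ := by ring

/-! ### Dyadic roots and the constants `ρ` and `L` -/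

theorem dyadicRoot_pos (s : ℕ) {x : ℝ} (hx : 0 < x) : 0 < dyadicRoot s x :=
  Real.rpow_pos_of_pos hx _

theorem one_lt_dyadicRoot (s : ℕ) {M : ℝ} (hM : 1 < M) : 1 < dyadicRoot s M :=
  Real.one_lt_rpow hM (by positivity)

theorem log_dyadicRoot (s : ℕ) {x : ℝ} (hx : 0 < x) :
    2 ^ s * Real.log (dyadicRoot s x) = Real.log x := by
  rw [dyadicRoot, Real.log_rpow hx]
  field_simp

theorem pos_of_mem_interval {M x : ℝ} (hM : 1 < M) (hx : x ∈ interval M) : 0 < x :=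
  lt_of_lt_of_le (by positivity) hx.1

theorem dyadicRoot_le (s : ℕ) {M x : ℝ} (hM : 1 < M) (hx : x ∈ interval M) :
    dyadicRoot s x ≤ dyadicRoot s M :=
  Real.rpow_le_rpow (pos_of_mem_interval hM hx).le hx.2 (by positivity)

theorem one_le_dyadicRoot_mul (s : ℕ) {M x : ℝ} (hM : 1 < M) (hx : x ∈ interval M) :
    1 ≤ dyadicRoot s x * dyadicRoot s M := by
  have hM0 : 0 < M := by linarith
  rw [dyadicRoot, dyadicRoot, ← Real.mul_rpow (pos_of_mem_interval hM hx).le hM0.le]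
  refine Real.one_le_rpow ?_ (by positivity)
  exact (div_le_iff₀ hM0).1 hx.1

theorem one_lt_rho {M : ℝ} (hM : 1 < M) (s : ℕ) : 1 < rho M s := by
  have := one_lt_dyadicRoot s hM
  rw [rho, lt_div_iff₀ (by linarith)]
  linarith

theorem bigL_eq {M : ℝ} (hM : 1 < M) (s : ℕ) :
    bigL M s = 2 ^ s * (2 * rho M s) / (rho M s ^ 2 - 1) := by
  have h := one_lt_rho hM s
  have h0 : rho M s ≠ 0 := by linarith
  have h1 : rho M s ^ 2 - 1 ≠ 0 := by nlinarith
  have e : rho M s - rho M s / 2 - (rho M s)⁻¹ / 2 = (rho M s ^ 2 - 1) / (2 * rho M s) := by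
    field_simp; ring
  rw [bigL, ← rho, e, div_div_eq_mul_div]

theorem bigL_pos {M : ℝ} (hM : 1 < M) (s : ℕ) : 0 < bigL M s := by
  have h := one_lt_rho hM s
  rw [bigL_eq hM]
  have : 0 < rho M s ^ 2 - 1 := by nlinarith
  positivity

/-- The Cayley transform `(x^{1/2^s} - 1) / (x^{1/2^s} + 1)` is bounded by `1 / ρ`. -/
theorem abs_dyadicRoot_sub_one_le {M x : ℝ} (hM : 1 < M) (s : ℕ) (hx : x ∈ interval M) :
    |dyadicRoot s x - 1| * rho M s ≤ dyadicRoot s x + 1 := by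
  have h1 := one_lt_dyadicRoot s hM
  have h2 := dyadicRoot_le s hM hx
  have h3 := one_le_dyadicRoot_mul s hM hx
  rw [rho, ← mul_div_assoc, div_le_iff₀ (by linarith)]
  -- For a root at least 1 this amounts to `x ≤ M` in terms of roots, for a root below 1 to `1 ≤ x
  -- M`.
  rcases abs_cases (dyadicRoot s x - 1) with ⟨h, _⟩ | ⟨h, _⟩ <;> rw [h] <;> nlinarith

/-! ### Integral representation and quadrature error -/

theorem phi2_den_pos {m t : ℝ} (hm : 0 < m) (ht : t ∈ Set.Icc (-1 : ℝ) 1) :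
    0 < 2 + (t + 1) * (m - 1) := by
  rcases ht.2.lt_or_eq with h | rfl
  · nlinarith [ht.1, mul_nonneg (by linarith [ht.1] : 0 ≤ t + 1) hm.le]
  · linarith

theorem integral_phi2 (s : ℕ) {x : ℝ} (hx : 0 < x) :
    ∫ t in (-1 : ℝ)..1, phi2 s t x = Real.log x := by
  set m := dyadicRoot s x with hm
  have hm0 : 0 < m := dyadicRoot_pos s hx
  have hd : ∀ t ∈ Set.uIcc (-1 : ℝ) 1,
      HasDerivAt (fun t => 2 ^ s * Real.log (2 + (t + 1) * (m - 1))) (phi2 s t x) t := by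
    intro t ht
    rw [Set.uIcc_of_le (by norm_num)] at ht
    have h1 : HasDerivAt (fun t : ℝ => 2 + (t + 1) * (m - 1)) (m - 1) t := by
      simpa using (((hasDerivAt_id t).add_const (1 : ℝ)).mul_const (m - 1)).const_add 2
    have h2 := (h1.log (phi2_den_pos hm0 ht).ne').const_mul ((2 : ℝ) ^ s)
    rwa [← mul_div_assoc] at h2
  have hc : ContinuousOn (fun t => phi2 s t x) (Set.uIcc (-1) 1) := by
    rw [Set.uIcc_of_le (by norm_num)]
    unfold phi2
    refine ContinuousOn.div (by fun_prop) (by fun_prop) fun t ht => (phi2_den_pos hm0 ht).ne'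
  rw [intervalIntegral.integral_eq_sub_of_hasDerivAt hd hc.intervalIntegrable, ← mul_sub,
    ← log_dyadicRoot s hx, ← hm]
  congr 1
  have e1 : 2 + ((1 : ℝ) + 1) * (m - 1) = 2 * m := by ring
  have e2 : 2 + ((-1 : ℝ) + 1) * (m - 1) = 2 := by ring
  rw [e1, e2, Real.log_mul two_ne_zero hm0.ne']
  ring

/-- Quadrature error from truncating the geometric series of `φ₂` in its first argument. -/
theorem abs_log_sub_gauss_le {M x : ℝ} (hM : 1 < M) (s : ℕ) {N : ℕ} (hN : 0 < N)
    (hx : x ∈ interval M) :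
    |Real.log x - ∑ k, gaussWeight N k * phi2 s (gaussNode N k) x| ≤
      4 * (2 ^ s * ((rho M s)⁻¹ ^ (2 * N + 1) / (1 - (rho M s)⁻¹))) := by
  have hx0 := pos_of_mem_interval hM hx
  set m := dyadicRoot s x with hm
  have hm0 : 0 < m := dyadicRoot_pos s hx0
  set u := (rho M s)⁻¹ with hu
  have hρ := one_lt_rho hM s
  have hu1 : u < 1 := inv_lt_one_of_one_lt₀ hρ
  set a := (m - 1) / (m + 1) with ha
  have hau : |a| ≤ u := by
    rw [ha, abs_div, abs_of_pos (by linarith : 0 < m + 1), hu, div_le_iff₀ (by linarith),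
      ← div_eq_inv_mul, le_div_iff₀ (by linarith)]
    exact abs_dyadicRoot_sub_one_le hM s hx
  have hphi : ∀ t ∈ Set.Icc (-1 : ℝ) 1, phi2 s t x = 2 ^ s * (a / (1 + a * t)) := by
    intro t ht
    have h1 := phi2_den_pos hm0 ht
    have h2 : (1 + a * t) = (2 + (t + 1) * (m - 1)) / (m + 1) := by
      rw [ha]; field_simp; ring
    rw [phi2, h2, ha, ← hm]
    field_simp
  have hden : ∀ t ∈ Set.Icc (-1 : ℝ) 1, |a * t| ≤ u := by
    intro t ht
    rw [abs_mul]
    exact (mul_le_of_le_one_right (abs_nonneg a) (abs_le.2 ht)).trans hau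
  rw [← integral_phi2 s hx0]
  -- Partial sum of the geometric series up to degree `2N - 1`, the largest degree covered by the
  -- exactness of the rule.
  refine abs_integral_sub_gauss_le hN (f := fun t => phi2 s t x) ?_
    (C (2 ^ s) * ∑ k ∈ Finset.range (2 * N), C (a * (-a) ^ k) * X ^ k) ?_ ?_
  · unfold phi2
    refine ContinuousOn.div (by fun_prop) (by fun_prop) fun t ht => (phi2_den_pos hm0 ht).ne'
  · refine (natDegree_C_mul_le _ _).trans_lt (lt_of_le_of_lt
      (natDegree_sum_le_of_forall_le (n := 2 * N - 1) _ _ fun k hk => ?_) (by omega))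
    refine (natDegree_C_mul_X_pow_le _ _).trans ?_
    have := Finset.mem_range.1 hk
    omega
  · intro t ht
    have h1 := hden t ht
    have hpos : 0 < 1 + a * t := by linarith [neg_abs_le (a * t)]
    have hs : ∑ k ∈ Finset.range (2 * N), a * (-a) ^ k * t ^ k =
        a * (1 - (a * t) ^ (2 * N)) / (1 + a * t) := by
      have h3 := geom_sum_mul_neg (-(a * t)) (2 * N)
      rw [sub_neg_eq_add, (even_two_mul N).neg_pow] at h3
      rw [eq_div_iff hpos.ne', ← h3, ← mul_assoc, Finset.mul_sum]
      congr 1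
      refine Finset.sum_congr rfl fun k _ => ?_
      rw [mul_assoc, ← mul_pow, neg_mul]
    have he : phi2 s t x - (C (2 ^ s) * ∑ k ∈ Finset.range (2 * N),
        C (a * (-a) ^ k) * X ^ k : ℝ[X]).eval t =
        2 ^ s * (a * (a * t) ^ (2 * N) / (1 + a * t)) := by
      rw [hphi t ht, eval_C_mul, eval_finsetSum]
      simp only [eval_C_mul, eval_pow, eval_X]
      rw [hs]
      field_simp
      ring
    rw [he, abs_mul, abs_of_pos (by positivity : (0 : ℝ) < 2 ^ s), abs_div, abs_of_pos hpos,
      abs_mul, abs_pow, pow_succ']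
    have hu0 : 0 ≤ u := (abs_nonneg _).trans hau
    refine mul_le_mul_of_nonneg_left ?_ (by positivity)
    refine div_le_div₀ (by positivity) ?_ (by linarith) (by linarith [neg_abs_le (a * t)])
    gcongr

theorem gauss_error_le {M : ℝ} (hM : 1 < M) (s : ℕ) {N : ℕ} (hN : 0 < N) :
    4 * (2 ^ s * ((rho M s)⁻¹ ^ (2 * N + 1) / (1 - (rho M s)⁻¹))) ≤
      64 * bigL M s / (15 * (rho M s ^ 2 - 1) * rho M s ^ (2 * (N - 1))) := by
  obtain ⟨n, rfl⟩ : ∃ n, N = n + 1 := ⟨N - 1, by omega⟩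
  rw [bigL_eq hM, Nat.add_sub_cancel]
  have hρ := one_lt_rho hM s
  set ρ := rho M s
  have hρ0 : 0 < ρ := by linarith
  have h1 : 0 < ρ - 1 := by linarith
  have h2 : 0 < ρ ^ 2 - 1 := by nlinarith
  have e1 : 4 * (2 ^ s * (ρ⁻¹ ^ (2 * (n + 1) + 1) / (1 - ρ⁻¹))) =
      2 ^ s / ρ ^ (2 * n) * (4 / (ρ ^ 2 * (ρ - 1))) := by
    rw [show 2 * (n + 1) + 1 = 2 * n + 3 by ring, pow_add, inv_pow, inv_pow]
    field_simp
  have e2 : 64 * (2 ^ s * (2 * ρ) / (ρ ^ 2 - 1)) / (15 * (ρ ^ 2 - 1) * ρ ^ (2 * n)) =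
      2 ^ s / ρ ^ (2 * n) * (128 * ρ / (15 * (ρ ^ 2 - 1) ^ 2)) := by
    field_simp
    ring
  rw [e1, e2]
  refine mul_le_mul_of_nonneg_left ?_ (by positivity)
  rw [div_le_div_iff₀ (by positivity) (by positivity)]
  -- The ratio `(ρ - 1)(ρ + 1)²/ρ³` is largest at `ρ = 3`, with value `32/27 < 128/60`; hence the
  -- hint with `ρ - 3`.
  have key : 60 * ((ρ - 1) * (ρ + 1) ^ 2) ≤ 128 * ρ ^ 3 := by
    nlinarith [pow_pos hρ0 3, mul_pos hρ0 hρ0, mul_nonneg hρ0.le (sq_nonneg (ρ - 3))]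
  calc 4 * (15 * (ρ ^ 2 - 1) ^ 2) = (ρ - 1) * (60 * ((ρ - 1) * (ρ + 1) ^ 2)) := by ring
    _ ≤ (ρ - 1) * (128 * ρ ^ 3) := by gcongr
    _ = 128 * ρ * (ρ ^ 2 * (ρ - 1)) := by ring

/-! ### Boundedness on the elliptic region -/

theorem norm_le_of_mem_bernsteinEllipse {r ρ : ℝ} (hr : r ∈ Set.Icc 1 ρ) {z : ℂ}
    (hz : z ∈ bernsteinEllipse r) : ‖z‖ ≤ ρ / 2 + ρ⁻¹ / 2 := by
  obtain ⟨θ, -, rfl⟩ := hz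
  have hr0 : 0 < r := by linarith [hr.1]
  have hρ0 : 0 < ρ := hr0.trans_le hr.2
  have e1 : ‖Complex.exp (Complex.I * θ)‖ = 1 := by
    rw [mul_comm]; exact Complex.norm_exp_ofReal_mul_I θ
  have e2 : ‖Complex.exp (-(Complex.I * θ))‖ = 1 := by
    rw [Complex.exp_neg, norm_inv, e1, inv_one]
  refine (norm_add_le _ _).trans ?_
  rw [norm_mul, norm_mul, e1, e2, norm_div, norm_div, norm_inv, Complex.norm_real,
    Real.norm_of_nonneg hr0.le, Complex.norm_ofNat, mul_one, mul_one]
  -- The sum `r + 1/r` is increasing for `r ≥ 1`.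
  have h1 : r + r⁻¹ ≤ ρ + ρ⁻¹ := by
    have : ρ + ρ⁻¹ - (r + r⁻¹) = (ρ - r) * (r * ρ - 1) / (r * ρ) := by field_simp; ring
    have h2 : 0 ≤ (ρ - r) * (r * ρ - 1) / (r * ρ) := by
      have := hr.1
      have := hr.2
      refine div_nonneg (mul_nonneg (by linarith) ?_) (by positivity)
      nlinarith
    linarith
  linarith

/-- The confocal ellipses with `1 ≤ r ≤ ρ` sweep out the closed region. There the denominator `(m +
1) + z (m - 1)` has modulus at least `|m - 1| (ρ - |z|)`, because `m + 1 ≥ ρ |m - 1|`. -/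
theorem phi2C_bound {M x : ℝ} (hM : 1 < M) (s : ℕ) (hx : x ∈ interval M) {r : ℝ}
    (hr : r ∈ Set.Icc 1 (rho M s)) {z : ℂ} (hz : z ∈ bernsteinEllipse r) :
    phi2DenC s z x ≠ 0 ∧ ‖phi2C s z x‖ ≤ bigL M s := by
  have hzn := norm_le_of_mem_bernsteinEllipse hr hz
  have hρ := one_lt_rho hM s
  have hρ' : (rho M s)⁻¹ < 1 := inv_lt_one_of_one_lt₀ hρ
  have hb := abs_dyadicRoot_sub_one_le hM s hx
  have hm0 := dyadicRoot_pos s (pos_of_mem_interval hM hx)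
  set m := dyadicRoot s x with hm
  have hL : bigL M s = 2 ^ s / (rho M s - rho M s / 2 - (rho M s)⁻¹ / 2) := rfl
  set ρ := rho M s
  set d := ρ - ρ / 2 - ρ⁻¹ / 2 with hd
  have hd0 : 0 < d := by linarith
  have hden : |m - 1| * d ≤ ‖phi2DenC s z x‖ ∧ 0 < ‖phi2DenC s z x‖ := by
    have e : phi2DenC s z x = ((m + 1 : ℝ) : ℂ) + z * ((m - 1 : ℝ) : ℂ) := by
      rw [phi2DenC, ← hm]; push_cast; ring
    have h1 : (m + 1) - ‖z‖ * |m - 1| ≤ ‖phi2DenC s z x‖ := by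
      have := norm_sub_le_norm_add ((m + 1 : ℝ) : ℂ) (z * ((m - 1 : ℝ) : ℂ))
      rw [norm_mul, Complex.norm_real, Complex.norm_real, Real.norm_of_nonneg (by linarith),
        Real.norm_eq_abs] at this
      rwa [e]
    have h2 : ‖z‖ * |m - 1| ≤ (ρ / 2 + ρ⁻¹ / 2) * |m - 1| :=
      mul_le_mul_of_nonneg_right hzn (abs_nonneg _)
    refine ⟨by rw [hd]; linarith, ?_⟩
    -- At `m = 1` the lower bound degenerates to 0, but the denominator is then `m + 1`.
    rcases (abs_nonneg (m - 1)).eq_or_lt with h | h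
    · rw [← h] at h1
      linarith
    · nlinarith [mul_pos h hd0]
  refine ⟨norm_pos_iff.1 hden.2, ?_⟩
  have en : ‖(2 ^ s * ((m : ℂ) - 1))‖ = 2 ^ s * |m - 1| := by
    rw [norm_mul, norm_pow, Complex.norm_ofNat, ← Complex.ofReal_one, ← Complex.ofReal_sub,
      Complex.norm_real, Real.norm_eq_abs]
  rw [phi2C, ← hm, norm_div, en, hL, div_le_div_iff₀ hden.2 hd0, mul_assoc]
  exact mul_le_mul_of_nonneg_left hden.1 (by positivity)

/-! ### Second-order cone representation -/

theorem mem_lorentz_two {a b c : ℝ} :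
    ![a, b, c] ∈ lorentz 2 ↔ 0 ≤ c ∧ a ^ 2 + b ^ 2 ≤ c ^ 2 := by
  have : ![a, b, c] ∈ lorentz 2 ↔ Real.sqrt (a ^ 2 + b ^ 2) ≤ c := by
    simp [lorentz, Fin.sum_univ_two, Fin.last]
  rw [this, Real.sqrt_le_iff]

theorem chain_iff {r x : ℝ} (hx : 0 ≤ x) :
    ![2 * r, x - 1, x + 1] ∈ lorentz 2 ↔ r ^ 2 ≤ x := by
  rw [mem_lorentz_two]
  constructor
  · rintro ⟨-, h⟩; linarith
  · intro h; exact ⟨by linarith, by linarith⟩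

theorem dyadicRoot_succ_sq (s : ℕ) {x : ℝ} (hx : 0 ≤ x) :
    dyadicRoot (s + 1) x ^ 2 = dyadicRoot s x := by
  rw [dyadicRoot, dyadicRoot, ← Real.rpow_natCast, ← Real.rpow_mul hx]
  congr 1
  push_cast
  rw [pow_succ]
  field_simp

theorem dyadicRoot_zero (x : ℝ) : dyadicRoot 0 x = x := by simp [dyadicRoot]

theorem two_zpow_one_sub (s : ℕ) : (2 : ℝ) ^ (1 - (s : ℤ)) = 2 / 2 ^ s := by
  rw [zpow_sub₀ two_ne_zero, zpow_one, zpow_natCast]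

theorem two_zpow_three_sub (s : ℕ) : (2 : ℝ) ^ (3 - (s : ℤ)) = 8 / 2 ^ s := by
  rw [zpow_sub₀ two_ne_zero, zpow_natCast]; norm_num

/-- The product form of the cone constraint coupling `v` with the last root variable `r`. -/
theorem gamma_cone_iff {s : ℕ} {t v r : ℝ} (ht : 0 ≤ t + 1)
    (h1 : 0 ≤ 2 ^ s - (t + 1) * v) (h2 : 0 ≤ r - 1 - (2 : ℝ) ^ (1 - (s : ℤ)) * v) :
    ![v * Real.sqrt ((2 : ℝ) ^ (3 - (s : ℤ)) * (t + 1)),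
      (2 ^ s - (t + 1) * v) - (r - 1 - (2 : ℝ) ^ (1 - (s : ℤ)) * v),
      (2 ^ s - (t + 1) * v) + (r - 1 - (2 : ℝ) ^ (1 - (s : ℤ)) * v)] ∈ lorentz 2 ↔
    v * (2 + (t + 1) * (r - 1)) ≤ 2 ^ s * (r - 1) := by
  have hs : (2 : ℝ) ^ s ≠ 0 := by positivity
  rw [mem_lorentz_two, mul_pow, Real.sq_sqrt (by positivity), two_zpow_three_sub]
  rw [two_zpow_one_sub] at h2 ⊢
  -- The difference is `4 γ₁ γ₂` minus the square of the first entry; the factor `2^(3-s)` is chosen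
  -- so that the `v²` terms cancel.
  have key : ((2 ^ s - (t + 1) * v) + (r - 1 - 2 / 2 ^ s * v)) ^ 2 -
      (v ^ 2 * (8 / 2 ^ s * (t + 1)) + ((2 ^ s - (t + 1) * v) - (r - 1 - 2 / 2 ^ s * v)) ^ 2) =
      4 * (2 ^ s * (r - 1) - v * (2 + (t + 1) * (r - 1))) := by
    field_simp
    ring
  constructor
  · rintro ⟨-, h⟩; linarith
  · intro h; exact ⟨by linarith, by linarith⟩

/-- Needed because the chain bounds the last root variable only from above. As `r = 0` is allowed,
`t < 1` is what keeps the denominator positive. -/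
theorem phi2_mono {s : ℕ} {t r m : ℝ} (ht : t ∈ Set.Ioo (-1 : ℝ) 1) (hr : 0 ≤ r) (hm : r ≤ m)
    {v : ℝ} (h : v * (2 + (t + 1) * (r - 1)) ≤ 2 ^ s * (r - 1)) :
    v ≤ 2 ^ s * (m - 1) / (2 + (t + 1) * (m - 1)) := by
  have hd : 0 < 2 + (t + 1) * (r - 1) := by nlinarith [ht.1, ht.2]
  have hd' : 0 < 2 + (t + 1) * (m - 1) := by nlinarith [ht.1, ht.2]
  rw [← le_div_iff₀ hd] at h
  refine h.trans ?_
  rw [div_le_div_iff₀ hd hd']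
  have : (0 : ℝ) < 2 ^ s := by positivity
  nlinarith

/-- With the exact root in place of `r_s` the sign conditions cut nothing off: at `v = φ₂` the two
quantities are `2^(s+1)/d` and `(t + 1)(m - 1)²/d`, with `d` the denominator, and smaller `v` only
increases them. -/
theorem gamma_nonneg_of_le_phi2 {s : ℕ} {t m v : ℝ} (hm : 0 < m) (ht : t ∈ Set.Ioo (-1 : ℝ) 1)
    (hv : v ≤ 2 ^ s * (m - 1) / (2 + (t + 1) * (m - 1))) :
    0 ≤ 2 ^ s - (t + 1) * v ∧ 0 ≤ m - 1 - (2 : ℝ) ^ (1 - (s : ℤ)) * v := by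
  have hd := phi2_den_pos hm (Set.Ioo_subset_Icc_self ht)
  have ht1 : 0 < t + 1 := by linarith [ht.1]
  set d := 2 + (t + 1) * (m - 1) with hd_def
  constructor
  · have e : (t + 1) * (2 ^ s * (m - 1) / d) = 2 ^ s - 2 ^ s * 2 / d := by
      field_simp
      rw [hd_def]
      ring
    have h2 : 0 ≤ 2 ^ s * 2 / d := by positivity
    have := mul_le_mul_of_nonneg_left hv ht1.le
    linarith
  · rw [two_zpow_one_sub]
    have e : (2 : ℝ) / 2 ^ s * (2 ^ s * (m - 1) / d) = m - 1 - (t + 1) * (m - 1) ^ 2 / d := by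
      field_simp
      rw [hd_def]
      ring
    have h2 : 0 ≤ (t + 1) * (m - 1) ^ 2 / d := by positivity
    have := mul_le_mul_of_nonneg_left hv (by positivity : (0 : ℝ) ≤ 2 / 2 ^ s)
    linarith

theorem Hhat_eq {M : ℝ} (hM : 1 < M) (N s : ℕ) (hs : 0 < s) :
    Hhat M (phi2 s) 0 N =
      {p | ∃ (v : Fin N → ℝ) (r : Fin s → ℝ), Constraints M N s hs p.1 p.2 v r} := by
  ext ⟨x, ν⟩
  simp only [Hhat, hypGen, Set.mem_ofPred_eq, add_zero]
  constructor
  · rintro ⟨hx, v, hv, hk⟩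
    have hx0 := pos_of_mem_interval hM hx
    -- The exact roots make the whole chain tight; the shift comes from counting `i` from 0.
    refine ⟨v, fun i => dyadicRoot (i + 1) x, hx, hv, fun i => (dyadicRoot_pos _ hx0).le, ?_, ?_,
      fun k => ⟨_, _, rfl, ?_, rfl, ?_, ?_⟩⟩
    · rw [chain_iff hx0.le, dyadicRoot_succ_sq _ hx0.le, dyadicRoot_zero]
    · intro i hi
      rw [chain_iff (dyadicRoot_pos _ hx0).le, dyadicRoot_succ_sq _ hx0.le]
    all_goals
      have hφ := (hk k).2
      rw [phi2] at hφ
      have h := gamma_nonneg_of_le_phi2 (dyadicRoot_pos s hx0) (gaussNode_mem N k) hφ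
    · exact h.1
    · simp only [Nat.sub_add_cancel hs]
      exact h.2
    · simp only [Nat.sub_add_cancel hs]
      rw [gamma_cone_iff (by linarith [(gaussNode_mem N k).1]) h.1 h.2]
      exact (le_div_iff₀ (phi2_den_pos (dyadicRoot_pos s hx0)
        (Set.Ioo_subset_Icc_self (gaussNode_mem N k)))).1 hφ
  · rintro ⟨v, r, hx, hv, hr, hc0, hc, hg⟩
    have hx0 := pos_of_mem_interval hM hx
    -- Taking square roots along the chain keeps every variable below the exact root.
    have hrle : ∀ i (hi : i < s), r ⟨i, hi⟩ ≤ dyadicRoot (i + 1) x := by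
      intro i
      induction i with
      | zero =>
        intro hi
        rw [chain_iff hx0.le] at hc0
        refine abs_le_of_sq_le_sq' ?_ (dyadicRoot_pos _ hx0).le |>.2
        rw [dyadicRoot_succ_sq _ hx0.le, dyadicRoot_zero]
        exact hc0
      | succ i ih =>
        intro hi
        have h1 := hc i hi
        rw [chain_iff (hr _)] at h1
        refine abs_le_of_sq_le_sq' ?_ (dyadicRoot_pos _ hx0).le |>.2
        rw [dyadicRoot_succ_sq _ hx0.le]
        exact h1.trans (ih _)
    refine ⟨hx, v, hv, fun k => ⟨hx, ?_⟩⟩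
    obtain ⟨γ₁, γ₂, rfl, h1, rfl, h2, h3⟩ := hg k
    have ht := gaussNode_mem N k
    rw [gamma_cone_iff (by linarith [ht.1]) h1 h2] at h3
    have hm := hrle (s - 1) (Nat.sub_lt hs Nat.one_pos)
    rw [Nat.sub_add_cancel hs] at hm
    exact phi2_mono ht (hr _) hm h3

/-! ### Standard form of the constraint system -/

/-- Affine functionals `y ↦ a ⬝ᵥ y + b`. -/
def IsAffineFun {n : ℕ} (f : (Fin n → ℝ) → ℝ) : Prop :=
  ∃ (a : Fin n → ℝ) (b : ℝ), ∀ y, f y = a ⬝ᵥ y + b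

namespace IsAffineFun

variable {n : ℕ} {f g : (Fin n → ℝ) → ℝ}

theorem const (c : ℝ) : IsAffineFun (fun _ : Fin n → ℝ => c) := ⟨0, c, by simp⟩

theorem coord (i : Fin n) : IsAffineFun (fun y : Fin n → ℝ => y i) :=
  ⟨Pi.single i 1, 0, by simp⟩

theorem add (hf : IsAffineFun f) (hg : IsAffineFun g) : IsAffineFun (fun y => f y + g y) := by
  obtain ⟨a, b, h⟩ := hf
  obtain ⟨a', b', h'⟩ := hg
  exact ⟨a + a', b + b', fun y => by simp only [h, h', add_dotProduct]; ring⟩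

theorem const_mul (c : ℝ) (hf : IsAffineFun f) : IsAffineFun (fun y => c * f y) := by
  obtain ⟨a, b, h⟩ := hf
  exact ⟨c • a, c * b, fun y => by simp only [h, smul_dotProduct, smul_eq_mul]; ring⟩

theorem mul_const (c : ℝ) (hf : IsAffineFun f) : IsAffineFun (fun y => f y * c) := by
  simpa only [mul_comm] using hf.const_mul c

theorem sub (hf : IsAffineFun f) (hg : IsAffineFun g) : IsAffineFun (fun y => f y - g y) := by
  simpa only [sub_eq_add_neg, neg_one_mul] using hf.add (hg.const_mul (-1))

theorem sum {ι : Type*} (s : Finset ι) {F : ι → (Fin n → ℝ) → ℝ}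
    (h : ∀ i, IsAffineFun (F i)) : IsAffineFun (fun y => ∑ i ∈ s, F i y) := by
  classical
  induction s using Finset.induction_on with
  | empty => simpa using const 0
  | insert a s ha ih => simpa only [Finset.sum_insert ha] using (h a).add ih

end IsAffineFun

/-- An arbitrary finite index type lets the constraints be listed in blocks and numbered only at the
end. -/
theorem exists_SOCSystem {ι : Type*} [Fintype ι] {n m : ℕ} (hι : Fintype.card ι = m)
    (f₁ f₂ f₃ : ι → (Fin n → ℝ) → ℝ) (h₁ : ∀ i, IsAffineFun (f₁ i))
    (h₂ : ∀ i, IsAffineFun (f₂ i)) (h₃ : ∀ i, IsAffineFun (f₃ i)) :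
    ∃ S : SOCSystem n m, ∀ y, y ∈ S.solutions ↔ ∀ i, ![f₁ i y, f₂ i y, f₃ i y] ∈ lorentz 2 := by
  choose a₁ b₁ h₁ using h₁
  choose a₂ b₂ h₂ using h₂
  choose a₃ b₃ h₃ using h₃
  let e : Fin m ≃ ι := (Fintype.equivFinOfCardEq hι).symm
  refine ⟨⟨fun i => a₁ (e i), fun i => a₂ (e i), fun i => a₃ (e i), fun i => b₁ (e i),
    fun i => b₂ (e i), fun i => b₃ (e i)⟩, fun y => ?_⟩
  rw [← e.forall_congr_right]
  simp only [SOCSystem.solutions, Set.mem_ofPred_eq, Matrix.mulVec, h₁, h₂, h₃]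

theorem zero_zero_mem_lorentz {c : ℝ} : ![0, 0, c] ∈ lorentz 2 ↔ 0 ≤ c := by
  rw [mem_lorentz_two]
  exact ⟨And.left, fun h => ⟨h, by nlinarith⟩⟩

/-- The predecessor of `r_i` in the chain of roots: `x` for the first one. -/
def chainPrev {s : ℕ} (x : ℝ) (r : Fin s → ℝ) (i : Fin s) : ℝ :=
  if (i : ℕ) = 0 then x else r ⟨i - 1, by omega⟩

theorem chain_all_iff {s : ℕ} (hs : 0 < s) (x : ℝ) (r : Fin s → ℝ) :
    (∀ i, ![2 * r i, chainPrev x r i - 1, chainPrev x r i + 1] ∈ lorentz 2) ↔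
      ![2 * r ⟨0, hs⟩, x - 1, x + 1] ∈ lorentz 2 ∧
      ∀ (i : ℕ) (hi : i + 1 < s),
        ![2 * r ⟨i + 1, hi⟩, r ⟨i, Nat.lt_of_succ_lt hi⟩ - 1, r ⟨i, Nat.lt_of_succ_lt hi⟩ + 1]
          ∈ lorentz 2 := by
  constructor
  · intro h
    exact ⟨by simpa [chainPrev] using h ⟨0, hs⟩,
      fun i hi => by simpa [chainPrev] using h ⟨i + 1, hi⟩⟩
  · rintro ⟨h0, h⟩ ⟨i, hi⟩
    cases i with
    | zero => simpa [chainPrev] using h0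
    | succ i => simpa [chainPrev] using h i hi

theorem constraints_iff {M : ℝ} {N s : ℕ} (hs : 0 < s) (x ν : ℝ) (v : Fin N → ℝ)
    (r : Fin s → ℝ) : Constraints M N s hs x ν v r ↔
      (0 ≤ x - 1 / M ∧ 0 ≤ M - x ∧ 0 ≤ ∑ k, gaussWeight N k * v k - ν) ∧
      (∀ i, 0 ≤ r i) ∧
      (∀ i, ![2 * r i, chainPrev x r i - 1, chainPrev x r i + 1] ∈ lorentz 2) ∧
      (∀ k, 0 ≤ 2 ^ s - (gaussNode N k + 1) * v k) ∧
      (∀ k, 0 ≤ r ⟨s - 1, Nat.sub_lt hs Nat.one_pos⟩ - 1 - (2 : ℝ) ^ (1 - (s : ℤ)) * v k) ∧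
      ∀ k, ![v k * Real.sqrt ((2 : ℝ) ^ (3 - (s : ℤ)) * (gaussNode N k + 1)),
        (2 ^ s - (gaussNode N k + 1) * v k) -
          (r ⟨s - 1, Nat.sub_lt hs Nat.one_pos⟩ - 1 - (2 : ℝ) ^ (1 - (s : ℤ)) * v k),
        (2 ^ s - (gaussNode N k + 1) * v k) +
          (r ⟨s - 1, Nat.sub_lt hs Nat.one_pos⟩ - 1 - (2 : ℝ) ^ (1 - (s : ℤ)) * v k)]
          ∈ lorentz 2 := by
  rw [chain_all_iff hs]
  constructor
  · rintro ⟨hx, hv, hr, hc0, hc, hg⟩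
    refine ⟨⟨sub_nonneg.2 hx.1, sub_nonneg.2 hx.2, sub_nonneg.2 hv⟩, hr, ⟨hc0, hc⟩,
      fun k => ?_, fun k => ?_, fun k => ?_⟩ <;>
    obtain ⟨γ₁, γ₂, rfl, h1, rfl, h2, h3⟩ := hg k
    exacts [h1, h2, h3]
  · rintro ⟨⟨hx1, hx2, hv⟩, hr, ⟨hc0, hc⟩, h1, h2, h3⟩
    exact ⟨⟨sub_nonneg.1 hx1, sub_nonneg.1 hx2⟩, sub_nonneg.1 hv, hr, hc0, hc,
      fun k => ⟨_, _, rfl, h1 k, rfl, h2 k, h3 k⟩⟩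

theorem exists_SOCSystem_constraints (M : ℝ) (N s : ℕ) (hs : 0 < s) :
    ∃ S : SOCSystem (2 + (N + s)) (3 + 2 * s + 3 * N),
      ∀ (x ν : ℝ) (v : Fin N → ℝ) (r : Fin s → ℝ),
        Fin.append ![x, ν] (Fin.append v r) ∈ S.solutions ↔ Constraints M N s hs x ν v r := by
  let X : (Fin (2 + (N + s)) → ℝ) → ℝ := fun y => y (Fin.castAdd _ 0)
  let T : (Fin (2 + (N + s)) → ℝ) → ℝ := fun y => y (Fin.castAdd _ 1)
  let V : Fin N → (Fin (2 + (N + s)) → ℝ) → ℝ := fun k y => y (Fin.natAdd 2 (Fin.castAdd s k))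
  let R : (Fin (2 + (N + s)) → ℝ) → Fin s → ℝ := fun y i => y (Fin.natAdd 2 (Fin.natAdd N i))
  have hX : IsAffineFun X := .coord _
  have hT : IsAffineFun T := .coord _
  have hV : ∀ k, IsAffineFun (V k) := fun k => .coord _
  have hR : ∀ i, IsAffineFun (fun y => R y i) := fun i => .coord _
  let B : (Fin (2 + (N + s)) → ℝ) → Fin s → ℝ := fun y => chainPrev (X y) (R y)
  have hB : ∀ i, IsAffineFun (fun y => B y i) := by
    intro i
    by_cases h : (i : ℕ) = 0
    · simpa [B, chainPrev, h] using hX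
    · simpa [B, chainPrev, h] using hR _
  let G₁ : Fin N → (Fin (2 + (N + s)) → ℝ) → ℝ := fun k y =>
    2 ^ s - (gaussNode N k + 1) * V k y
  let G₂ : Fin N → (Fin (2 + (N + s)) → ℝ) → ℝ := fun k y =>
    R y ⟨s - 1, Nat.sub_lt hs Nat.one_pos⟩ - 1 - (2 : ℝ) ^ (1 - (s : ℤ)) * V k y
  have hG₁ : ∀ k, IsAffineFun (G₁ k) := fun k => (IsAffineFun.const _).sub ((hV k).const_mul _)
  have hG₂ : ∀ k, IsAffineFun (G₂ k) := fun k =>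
    ((hR _).sub (.const 1)).sub ((hV k).const_mul _)
  let Z : (Fin (2 + (N + s)) → ℝ) → ℝ := fun _ => 0
  have hZ : IsAffineFun Z := .const 0
  -- Blocks: two bounds on `x` and the sum inequality; signs of `r`; the chain; signs of `γ₁` and of
  -- `γ₂`; the coupling cones. Linear inequalities become cones with two zero entries.
  let ι := Fin 3 ⊕ Fin s ⊕ Fin s ⊕ Fin N ⊕ Fin N ⊕ Fin N
  obtain ⟨S, hS⟩ := exists_SOCSystem (ι := ι) (m := 3 + 2 * s + 3 * N)
    (by simp only [ι, Fintype.card_sum, Fintype.card_fin]; ring)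
    (Sum.elim (fun _ => Z) (Sum.elim (fun _ => Z) (Sum.elim (fun i y => 2 * R y i)
      (Sum.elim (fun _ => Z) (Sum.elim (fun _ => Z) (fun k y => V k y *
        Real.sqrt ((2 : ℝ) ^ (3 - (s : ℤ)) * (gaussNode N k + 1))))))))
    (Sum.elim (fun _ => Z) (Sum.elim (fun _ => Z) (Sum.elim (fun i y => B y i - 1)
      (Sum.elim (fun _ => Z) (Sum.elim (fun _ => Z) (fun k y => G₁ k y - G₂ k y))))))
    (Sum.elim ![fun y => X y - 1 / M, fun y => M - X y,
        fun y => ∑ k, gaussWeight N k * V k y - T y]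
      (Sum.elim (fun i y => R y i) (Sum.elim (fun i y => B y i + 1)
      (Sum.elim G₁ (Sum.elim G₂ (fun k y => G₁ k y + G₂ k y))))))
    (by
      rintro (_ | _ | i | _ | _ | k)
      exacts [hZ, hZ, (hR i).const_mul 2, hZ, hZ, (hV k).mul_const _])
    (by
      rintro (_ | _ | i | _ | _ | k)
      exacts [hZ, hZ, (hB i).sub (.const 1), hZ, hZ, (hG₁ k).sub (hG₂ k)])
    (by
      rintro (i | i | i | k | k | k)
      · fin_cases i
        exacts [hX.sub (.const _), (IsAffineFun.const _).sub hX,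
          (IsAffineFun.sum _ fun k => (hV k).const_mul _).sub hT]
      exacts [hR i, (hB i).add (.const 1), hG₁ k, hG₂ k, (hG₁ k).add (hG₂ k)])
  refine ⟨S, fun x ν v r => ?_⟩
  rw [hS, constraints_iff]
  set y := Fin.append ![x, ν] (Fin.append v r) with hy
  have eX : X y = x := by simp only [X, hy, Fin.append_left]; rfl
  have eT : T y = ν := by simp only [T, hy, Fin.append_left]; rfl
  have eV : ∀ k, V k y = v k := fun k => by simp only [V, hy, Fin.append_right, Fin.append_left]
  have eR : R y = r := by
    funext i
    simp only [R, hy, Fin.append_right]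
  simp only [ι, Sum.forall, Sum.elim_inl, Sum.elim_inr, Z, zero_zero_mem_lorentz, G₁, G₂, B, eX,
    eV, eR, Fin.forall_fin_succ]
  simp [eX, eT, eV]

/-! ### Convergence rate -/

/-- The inner inclusion takes `v_k = φ₂(t_k, x)`; the outer one needs nonnegative weights. -/
theorem Hhat_sandwich {M ε : ℝ} {s N : ℕ}
    (h : ∀ x ∈ interval M,
      |Real.log x - ∑ k, gaussWeight N k * phi2 s (gaussNode N k) x| ≤ ε) :
    hypLog M (-ε) ⊆ Hhat M (phi2 s) 0 N ∧ Hhat M (phi2 s) 0 N ⊆ hypLog M ε := by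
  constructor
  · rintro ⟨x, ν⟩ ⟨hx, hν⟩
    have := (abs_le.1 (h x hx)).2
    dsimp only at hx hν
    exact ⟨hx, fun k => phi2 s (gaussNode N k) x, by dsimp only; linarith, fun k => ⟨hx, le_rfl⟩⟩
  · rintro ⟨x, ν⟩ ⟨hx, v, hv, hk⟩
    refine ⟨hx, ?_⟩
    have h1 := (abs_le.1 (h x hx)).1
    have h2 : ∑ k, gaussWeight N k * v k ≤ ∑ k, gaussWeight N k * phi2 s (gaussNode N k) x :=
      Finset.sum_le_sum fun k _ => mul_le_mul_of_nonneg_left (hk k).2 (gaussWeight_nonneg N k)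
    dsimp only at hv h1 ⊢
    linarith

/-- With `m` the root of `M`: `(m - 1)/(m + 1) ≤ 1 - 1/m ≤ log m`. -/
theorem inv_rho_le {M : ℝ} (hM : 1 < M) (s : ℕ) : (rho M s)⁻¹ ≤ Real.log M / 2 ^ s := by
  have h1 := one_lt_dyadicRoot s hM
  have hl : Real.log M / 2 ^ s = Real.log (dyadicRoot s M) := by
    rw [← log_dyadicRoot s (by linarith : 0 < M)]; field_simp
  rw [hl, rho, inv_div]
  set m := dyadicRoot s M
  have h2 := Real.one_sub_inv_le_log_of_pos (by linarith : 0 < m)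
  refine le_trans ?_ h2
  have e : 1 - m⁻¹ = (m - 1) / m := by field_simp
  rw [e]
  exact div_le_div_of_nonneg_left (by linarith) (by linarith) (by linarith)

theorem geometric_error_le {u ε : ℝ} {N : ℕ} (hN : 2 ≤ N) (hu0 : 0 ≤ u)
    (hu : u ^ 2 ≤ (2 ^ (N + 2))⁻¹) (hε : ((2 : ℝ) ^ (N ^ 2))⁻¹ ≤ ε) :
    4 * (2 ^ N * (u ^ (2 * N + 1) / (1 - u))) ≤ ε := by
  refine le_trans ?_ hε
  have h4 : ((2 : ℝ) ^ (N + 2))⁻¹ ≤ (1 / 2) ^ 2 := by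
    rw [one_div, inv_pow]
    exact inv_anti₀ (by norm_num) (pow_le_pow_right₀ (by norm_num) (by omega))
  have hu2 : u ≤ 1 / 2 := (abs_le_of_sq_le_sq' (hu.trans h4) (by norm_num)).2
  have h5 : u / (1 - u) ≤ 1 := by
    rw [div_le_one (by linarith)]; linarith
  have h6 : u ^ (2 * N) ≤ ((2 : ℝ) ^ ((N + 2) * N))⁻¹ := by
    rw [pow_mul, pow_mul, ← inv_pow]
    exact pow_le_pow_left₀ (by positivity) hu N
  calc 4 * (2 ^ N * (u ^ (2 * N + 1) / (1 - u)))
      = 2 ^ (N + 2) * u ^ (2 * N) * (u / (1 - u)) := by rw [pow_succ u, pow_add]; ring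
    _ ≤ 2 ^ (N + 2) * u ^ (2 * N) * 1 := by gcongr
    _ ≤ 2 ^ (N + 2) * ((2 : ℝ) ^ ((N + 2) * N))⁻¹ := by rw [mul_one]; gcongr
    -- `N ≥ 2` absorbs the constant 4, and `(N + 2) N - 2N = N²`.
    _ ≤ 2 ^ (2 * N) * ((2 : ℝ) ^ ((N + 2) * N))⁻¹ := by
        gcongr
        · norm_num
        · omega
    _ = ((2 : ℝ) ^ (N ^ 2))⁻¹ := by
        rw [show (N + 2) * N = 2 * N + N ^ 2 by ring, pow_add (2 : ℝ) (2 * N)]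
        field_simp

theorem exists_gauss_size : ∃ C : ℝ, 0 < C ∧ ∀ M ε : ℝ, 1 < M → 0 < ε →
    ∃ N₀ : ℕ, 0 < N₀ ∧
      (((2 + (N₀ + N₀)) + (3 + 2 * N₀ + 3 * N₀) : ℕ) : ℝ) ≤ C * rate M ε ∧
      ∀ N : ℕ, N₀ ≤ N →
        hypLog M (-ε) ⊆ Hhat M (phi2 N) 0 N ∧ Hhat M (phi2 N) 0 N ⊆ hypLog M ε := by
  -- The count is `5 + 7 N₀` with `N₀ ≤ 3 + 3l + 2√R`, so 33 leaves room.
  refine ⟨33, by norm_num, fun M ε hM hε => ?_⟩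
  rw [rate]
  set l := max (Real.log (Real.log M)) 0 with hl
  set R := max (Real.log M + Real.log (1 / ε)) 0 with hR
  have hl0 : 0 ≤ l := le_max_right _ _
  have hR0 : 0 ≤ R := le_max_right _ _
  have hs0 := Real.sqrt_nonneg R
  have hlogM : 0 < Real.log M := Real.log_pos hM
  -- `2 + 3l` yields `4 (log M)² ≤ 2^N`, as `3 log 2 ≥ 2`; `2√R` yields `N² log 2 ≥ R ≥ log (1/ε)`.
  refine ⟨⌈2 + 3 * l + 2 * Real.sqrt R⌉₊, Nat.ceil_pos.2 (by positivity), ?_, fun N hN => ?_⟩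
  · have := (Nat.ceil_lt_add_one (by positivity : 0 ≤ 2 + 3 * l + 2 * Real.sqrt R)).le
    push_cast
    linarith
  · have hN' := Nat.ceil_le.1 hN
    have hN2 : 2 ≤ N := by
      have : (2 : ℝ) ≤ N := by linarith
      exact_mod_cast this
    refine Hhat_sandwich fun x hx => (abs_log_sub_gauss_le hM N (by omega) hx).trans ?_
    have hρ := one_lt_rho hM N
    have hlog2 := Real.log_two_gt_d9
    have hpow : ∀ n : ℕ, (2 : ℝ) ^ n = Real.exp (n * Real.log 2) := fun n => by
      rw [Real.exp_nat_mul, Real.exp_log two_pos]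
    refine geometric_error_le hN2 (inv_nonneg.2 (by linarith)) ?_ ?_
    · have h1 : Real.log M ≤ Real.exp l := by
        rw [← Real.exp_log hlogM, Real.exp_le_exp]
        exact le_max_left _ _
      have h2 : 4 * Real.log M ^ 2 ≤ 2 ^ N := by
        calc 4 * Real.log M ^ 2 ≤ 4 * Real.exp l ^ 2 := by gcongr
          _ = Real.exp ((2 : ℕ) * Real.log 2 + (2 : ℕ) * l) := by
              rw [Real.exp_add, ← hpow, Real.exp_nat_mul l]; norm_num
          _ ≤ Real.exp (N * Real.log 2) := by
              rw [Real.exp_le_exp]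
              have : (2 + 3 * l) * Real.log 2 ≤ N * Real.log 2 := by
                gcongr
                linarith
              push_cast
              nlinarith
          _ = 2 ^ N := (hpow N).symm
      calc (rho M N)⁻¹ ^ 2 ≤ (Real.log M / 2 ^ N) ^ 2 :=
            pow_le_pow_left₀ (inv_nonneg.2 (by linarith)) (inv_rho_le hM N) 2
        _ = (4 * Real.log M ^ 2) / (2 ^ N * 2 ^ (N + 2)) := by
            rw [pow_add]; field_simp; norm_num
        _ ≤ 2 ^ N / (2 ^ N * 2 ^ (N + 2)) := by gcongr
        _ = (2 ^ (N + 2))⁻¹ := by field_simp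
    · rw [hpow, ← Real.exp_neg, ← Real.exp_log hε, Real.exp_le_exp]
      have h1 : -Real.log ε ≤ R := by
        have := le_max_left (Real.log M + Real.log (1 / ε)) 0
        rw [one_div, Real.log_inv] at this
        rw [hR, one_div, Real.log_inv]
        linarith
      have h2 : 2 * R ≤ (N : ℝ) ^ 2 := by
        have h3 : 2 * Real.sqrt R ≤ N := by linarith
        have := pow_le_pow_left₀ (by positivity) h3 2
        rw [mul_pow, Real.sq_sqrt hR0] at this
        linarith
      push_cast
      nlinarith

end LogSOC

theorem mainTheorem3 :
    -- the parameters `ρ` and `L` are admissible in the quadrature error estimate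
    (∀ (M : ℝ), 1 < M → ∀ s : ℕ, 0 < s →
      1 < LogSOC.rho M s ∧ 0 < LogSOC.bigL M s ∧
      (∀ x ∈ LogSOC.interval M, ∀ r ∈ Set.Icc 1 (LogSOC.rho M s),
        ∀ z ∈ LogSOC.bernsteinEllipse r,
          LogSOC.phi2DenC s z x ≠ 0 ∧ ‖LogSOC.phi2C s z x‖ ≤ LogSOC.bigL M s) ∧
      (∀ N : ℕ, 0 < N → ∀ x ∈ LogSOC.interval M,
        |Real.log x - ∑ k, LogSOC.gaussWeight N k * LogSOC.phi2 s (LogSOC.gaussNode N k) x|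
          ≤ 64 * LogSOC.bigL M s /
            (15 * (LogSOC.rho M s ^ 2 - 1) * LogSOC.rho M s ^ (2 * (N - 1))))) ∧
    -- the explicit representation, with `2 + N + s` variables and `3 + 2 s + 3 N` constraints
    (∀ (M : ℝ), 1 < M → ∀ (N s : ℕ) (_ : 0 < N) (hs : 0 < s),
      LogSOC.Hhat M (LogSOC.phi2 s) 0 N =
        {p | ∃ (v : Fin N → ℝ) (r : Fin s → ℝ), LogSOC.Constraints M N s hs p.1 p.2 v r} ∧
      ∃ S : LogSOC.SOCSystem (2 + (N + s)) (3 + 2 * s + 3 * N),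
        ∀ (x ν : ℝ) (v : Fin N → ℝ) (r : Fin s → ℝ),
          Fin.append ![x, ν] (Fin.append v r) ∈ S.solutions ↔
            LogSOC.Constraints M N s hs x ν v r) ∧
    -- with `s = N`, the number of points, variables and constraints for accuracy `ε`
    (∃ C : ℝ, 0 < C ∧ ∀ M ε : ℝ, 1 < M → 0 < ε →
      ∃ N₀ : ℕ, 0 < N₀ ∧
        (((2 + (N₀ + N₀)) + (3 + 2 * N₀ + 3 * N₀) : ℕ) : ℝ) ≤ C * LogSOC.rate M ε ∧
        ∀ N : ℕ, N₀ ≤ N →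
          LogSOC.hypLog M (-ε) ⊆ LogSOC.Hhat M (LogSOC.phi2 N) 0 N ∧
          LogSOC.Hhat M (LogSOC.phi2 N) 0 N ⊆ LogSOC.hypLog M ε) := by
  exact ⟨fun M hM s _ => ⟨LogSOC.one_lt_rho hM s, LogSOC.bigL_pos hM s,
      fun x hx r hr z hz => LogSOC.phi2C_bound hM s hx hr hz,
      fun N hN x hx => (LogSOC.abs_log_sub_gauss_le hM s hN hx).trans
        (LogSOC.gauss_error_le hM s hN)⟩,
    fun M hM N s _ hs => ⟨LogSOC.Hhat_eq hM N s hs,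
      LogSOC.exists_SOCSystem_constraints M N s hs⟩,
    LogSOC.exists_gauss_size⟩
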